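/- All formulae are propositional. A default $d=\frac{\alpha:\beta}{\gamma}$ consists of a precondition $prec(d)=\alpha$, a justification $just(d)=\beta$ and a consequence $cons(d)=\gamma$. A default theory is a pair $T=\langle D,W\rangle$ of a finite set $D$ of defaults and a finite consistent set $W$ of formulae. A process of $T$ is a sequence $\Pi$ of distinct defaults of $D$ such that $W\cup cons(\Pi)$ is consistent and, for every $d$ in $\Pi$, $W\cup cons(\Pi[d])\models prec(d)$, where $\Pi[d]$ is the part of $\Pi$ that precedes $d$. A semantics of default logic is given by two conditions, successfulness and closure, on a theory and a process. It is regular if (i) whenever $\Pi\cdot\Pi'$ is a successful process, so is $\Pi$; (ii) the empty process is successful; (iii) for each of the two conditions there is a polynomial-time computable list of formulae $\omega_1,\dots,\omega_u$, depending on $T$ and $\Pi$, such that the condition can be decided in polynomial time from $T$, $\Pi$ and the $u$ truth values "$\omega_i$ is consistent", where neither the formulae nor the decision depends on the order of the defaults in $\Pi$. A regular semantics is fail-safe if, for every default theory, every successful process is a prefix of a successful and closed process. An extension of $T$ is the deductive closure of $W\cup cons(\Pi)$ for a successful and closed process $\Pi$; $T\models a$ means that $a$ belongs to all extensions of $T$.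 Theorem. For every fail-safe regular semantics, deciding $T\models a$, for a given default theory $T$ and a given formula $a$ with the promise that $T\models a$ or $T\models\neg a$, is in $\Delta_2^p=\mathrm{P}^{\mathrm{NP}}$. That is, there is a language $L\in\mathrm{P}^{\mathrm{NP}}$ such that for all $T$ and $a$ for which $T\models a$ or $T\models\neg a$, the (encoded) pair $(T,a)$ belongs to $L$ if and only if $T\models a$. -/

import Mathlib

/-! ## Programs over binary trees, with oracle queries and a step count -/

/-- The data on which programs work: finite binary trees with unlabelled leaves. -/
inductive Data : Type
  | nil : Data
  | cons : Data → Data → Data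

namespace Data

/-- Number of nodes (leaves and inner nodes) of a tree. -/
def size : Data → ℕ
  | nil => 1
  | cons l r => 1 + size l + size r

/-- The left part of a tree. -/
def head : Data → Data
  | nil => nil
  | cons l _ => l

/-- The right part of a tree. -/
def tail : Data → Data
  | nil => nil
  | cons _ r => r

end Data

/-- Structured oracle programs over binary trees.  The store of a program is one tree (which may
hold several pieces of data, paired by `cons`); a program transforms it. -/
inductive Program : Type
  /-- leave the store as it is -/
  | skip : Program
  /-- store the leaf -/
  | clear : Program
  /-- replace the store by its left part -/
  | head : Program
  /-- replace the store by its right part -/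
  | tail : Program
  /-- run both programs on copies of the store and pair the results -/
  | pair : Program → Program → Program
  /-- run the first program, then the second one -/
  | seq : Program → Program → Program
  /-- `cond b p q`: if the test `b`, run on a copy of the store, does not return the leaf,
  run `p`, else run `q` -/
  | cond : Program → Program → Program → Program
  /-- `loop b p`: as long as the test `b`, run on a copy of the store, does not return the leaf,
  run `p` -/
  | loop : Program → Program → Program
  /-- ask the oracle whether the store belongs to the oracle set -/
  | query : Program

/-- Truth values as trees. -/
def boolData : Bool → Data
  | false => Data.nil
  | true => Data.cons Data.nil Data.nil

/-- `Run A p x y t`: with oracle set `A`, the program `p` started on the store `x` halts with the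
store `y` after `t` steps.  An elementary operation costs the size of the store plus a constant, so
that creating, copying and querying data is charged at least the size of these data. -/
inductive Run (A : Set Data) : Program → Data → Data → ℕ → Prop
  | skip (x : Data) : Run A Program.skip x x (1 + x.size)
  | clear (x : Data) : Run A Program.clear x Data.nil (1 + x.size)
  | head (x : Data) : Run A Program.head x x.head (1 + x.size)
  | tail (x : Data) : Run A Program.tail x x.tail (1 + x.size)
  | pair {p q : Program} {x y z : Data} {s t : ℕ} :
      Run A p x y s → Run A q x z t → Run A (Program.pair p q) x (Data.cons y z) (1 + s + t)
  | seq {p q : Program} {x y z : Data} {s t : ℕ} :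
      Run A p x y s → Run A q y z t → Run A (Program.seq p q) x z (1 + s + t)
  | cond_then {b p q : Program} {x l r y : Data} {s t : ℕ} :
      Run A b x (Data.cons l r) s → Run A p x y t → Run A (Program.cond b p q) x y (1 + s + t)
  | cond_else {b p q : Program} {x y : Data} {s t : ℕ} :
      Run A b x Data.nil s → Run A q x y t → Run A (Program.cond b p q) x y (1 + s + t)
  | loop_exit {b p : Program} {x : Data} {s : ℕ} :
      Run A b x Data.nil s → Run A (Program.loop b p) x x (1 + s)
  | loop_next {b p : Program} {x l r y z : Data} {s t u : ℕ} :
      Run A b x (Data.cons l r) s → Run A p x y t → Run A (Program.loop b p) y z u →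
      Run A (Program.loop b p) x z (1 + s + t + u)
  | query_yes {x : Data} : x ∈ A → Run A Program.query x (boolData true) (2 + x.size)
  | query_no {x : Data} : x ∉ A → Run A Program.query x (boolData false) (2 + x.size)

/-! ## Encodings and complexity classes -/

/-- Types whose elements are written as trees, to be processed by programs. -/
class TreeCode (α : Type) where
  code : α → Data

instance : TreeCode Bool := ⟨boolData⟩

instance {α β : Type} [TreeCode α] [TreeCode β] : TreeCode (α × β) :=
  ⟨fun x => Data.cons (TreeCode.code x.1) (TreeCode.code x.2)⟩

/-- Lists are coded as trees leaning to the right. -/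
def listData {α : Type} [TreeCode α] : List α → Data
  | [] => Data.nil
  | a :: l => Data.cons (TreeCode.code a) (listData l)

instance {α : Type} [TreeCode α] : TreeCode (List α) := ⟨listData⟩

/-- `f` is computable in polynomial time (deterministically and without oracle). -/
def PolyTime {α β : Type} [TreeCode α] [TreeCode β] (f : α → β) : Prop :=
  ∃ (p : Program) (q : Polynomial ℕ), ∀ x : α, ∃ t ≤ q.eval (TreeCode.code x).size,
    Run ∅ p (TreeCode.code x) (TreeCode.code (f x)) t

/-- `P^A`: the languages decided in deterministic polynomial time with the oracle set `A`. -/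
def classP (A : Set Data) : Set (Set Data) :=
  {L | ∃ (p : Program) (q : Polynomial ℕ), ∀ x : Data, ∃ t ≤ q.eval x.size,
    (x ∈ L → Run A p x (boolData true) t) ∧ (x ∉ L → Run A p x (boolData false) t)}

/-- `NP`: the languages with witnesses of polynomial size that are verifiable in polynomial time. -/
def classNP : Set (Set Data) :=
  {L | ∃ V ∈ classP ∅, ∃ q : Polynomial ℕ, ∀ x : Data,
    x ∈ L ↔ ∃ w : Data, w.size ≤ q.eval x.size ∧ Data.cons x w ∈ V}

/-- `Δ₂ᵖ = P^NP`. -/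
def classDeltaTwo : Set (Set Data) :=
  {L | ∃ A ∈ classNP, L ∈ classP A}

/-! ## Propositional logic -/

/-- Propositional formulae; a variable is given by its name, a word over a two-letter alphabet. -/
inductive Formula : Type
  | var : List Bool → Formula
  | bot : Formula
  | neg : Formula → Formula
  | and : Formula → Formula → Formula
  | or : Formula → Formula → Formula
  deriving DecidableEq

namespace Formula

/-- Truth of a formula under an assignment of truth values to the variables. -/
def Holds (v : List Bool → Bool) : Formula → Prop
  | var n => v n = true
  | bot => False
  | neg φ => ¬ Holds v φ
  | and φ ψ => Holds v φ ∧ Holds v ψ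
  | or φ ψ => Holds v φ ∨ Holds v ψ

/-- Syntax trees as data: the operands, preceded by a tag for the connective. -/
def toData : Formula → Data
  | bot => Data.nil
  | var n => Data.cons Data.nil (TreeCode.code n)
  | neg φ => Data.cons (Data.cons Data.nil Data.nil) (toData φ)
  | and φ ψ => Data.cons (Data.cons Data.nil (Data.cons Data.nil Data.nil))
      (Data.cons (toData φ) (toData ψ))
  | or φ ψ => Data.cons (Data.cons (Data.cons Data.nil Data.nil) Data.nil)
      (Data.cons (toData φ) (toData ψ))

instance : TreeCode Formula := ⟨toData⟩

end Formula

/-- A set of formulae is consistent if it has a model. -/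
def Consistent (Γ : Set Formula) : Prop :=
  ∃ v : List Bool → Bool, ∀ φ ∈ Γ, φ.Holds v

/-- `Γ ⊨ φ`: every model of `Γ` is a model of `φ`. -/
def Models (Γ : Set Formula) (φ : Formula) : Prop :=
  ∀ v : List Bool → Bool, (∀ ψ ∈ Γ, ψ.Holds v) → φ.Holds v

/-! ## Default theories and their processes -/

/-- A default, with precondition, (single) justification and consequence. -/
structure Default : Type where
  prec : Formula
  just : Formula
  cons : Formula
  deriving DecidableEq

instance : TreeCode Default :=
  ⟨fun d => TreeCode.code (d.prec, d.just, d.cons)⟩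

/-- A default theory `⟨D, W⟩`: finitely many defaults and a consistent background theory. -/
structure DefaultTheory : Type where
  D : Finset Default
  W : Finset Formula
  consistent : Consistent (W : Set Formula)

/-- `W ∪ cons(Π)`. -/
def DefaultTheory.conclusions (T : DefaultTheory) (s : List Default) : Set Formula :=
  {φ | φ ∈ T.W ∨ ∃ d ∈ s, d.cons = φ}

/-- A process of `T`: a sequence of distinct defaults of `T` whose consequences are consistent with
the background theory, and in which the precondition of each default is entailed by the background
theory and the consequences of the defaults that precede it. -/
def DefaultTheory.IsProc (T : DefaultTheory) (s : List Default) : Prop :=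
  s.Nodup ∧ (∀ d ∈ s, d ∈ T.D) ∧ Consistent (T.conclusions s) ∧
    ∀ (s₁ : List Default) (d : Default) (s₂ : List Default), s = s₁ ++ d :: s₂ →
      Models (T.conclusions s₁) d.prec

/-- How a default theory is given to a program: lists of its defaults and background formulae. -/
structure Presentation : Type where
  defaults : List Default
  background : List Formula
  consistent : Consistent {φ | φ ∈ background}

/-- The default theory that a presentation denotes. -/
def Presentation.theory (P : Presentation) : DefaultTheory where
  D := P.defaults.toFinset
  W := P.background.toFinset
  consistent := by
    obtain ⟨v, hv⟩ := P.consistent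
    exact ⟨v, fun φ hφ => hv φ (by simpa using hφ)⟩

instance : TreeCode Presentation :=
  ⟨fun P => TreeCode.code (P.defaults, P.background)⟩

/-! ## Semantics of default logic -/

/-- A semantics is given by two conditions on a default theory and a sequence of defaults. -/
structure DefaultSemantics : Type where
  Successful : DefaultTheory → List Default → Prop
  Closed : DefaultTheory → List Default → Prop

open Classical in
/-- The results of consistency tests of the given formulae. -/
noncomputable def testResults (l : List Formula) : List Bool :=
  l.map fun φ => decide (Consistent {φ})

/-- A condition on processes is expressible by consistency tests: the formulae to be tested are
computed in polynomial time from the theory and the process, the condition is decided in polynomial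
time from the theory, the process and the results of the tests, and neither depends on the order of
the defaults in the process. -/
def ExpressibleByTests (C : DefaultTheory → List Default → Prop) : Prop :=
  ∃ (tests : Presentation × List Default → List Formula)
    (combine : (Presentation × List Default) × List Bool → Bool),
    PolyTime tests ∧ PolyTime combine ∧
    (∀ (P : Presentation) (s s' : List Default), s.Perm s' → tests (P, s) = tests (P, s')) ∧
    (∀ (P : Presentation) (s s' : List Default) (r : List Bool), s.Perm s' →
      combine ((P, s), r) = combine ((P, s'), r)) ∧
    ∀ (P : Presentation) (s : List Default), P.theory.IsProc s →
      (C P.theory s ↔ combine ((P, s), testResults (tests (P, s))) = true)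

namespace DefaultSemantics

/-- `s` is a process of `T` and it is successful. -/
def IsSuccessful (S : DefaultSemantics) (T : DefaultTheory) (s : List Default) : Prop :=
  T.IsProc s ∧ S.Successful T s

/-- Regular semantics: successfulness is antimonotonic, the empty process is successful, and
successfulness and closure are polynomial-time combinations of consistency tests. -/
structure Regular (S : DefaultSemantics) : Prop where
  antimono : ∀ (T : DefaultTheory) (s s' : List Default),
    S.IsSuccessful T (s ++ s') → S.IsSuccessful T s
  empty : ∀ T : DefaultTheory, S.IsSuccessful T []
  successful_tests : ExpressibleByTests S.Successful
  closed_tests : ExpressibleByTests S.Closed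

/-- Fail-safe semantics: every successful process is the prefix of a successful and closed one. -/
def FailSafe (S : DefaultSemantics) : Prop :=
  ∀ (T : DefaultTheory) (s : List Default), S.IsSuccessful T s →
    ∃ s' : List Default, S.IsSuccessful T (s ++ s') ∧ S.Closed T (s ++ s')

/-- Extensions: the deductive closures of `W ∪ cons(Π)` for successful and closed processes `Π`. -/
def IsExtension (S : DefaultSemantics) (T : DefaultTheory) (E : Set Formula) : Prop :=
  ∃ s : List Default, S.IsSuccessful T s ∧ S.Closed T s ∧
    E = {φ | Models (T.conclusions s) φ}

/-- Skeptical consequence `T ⊨ φ`: the formula belongs to all extensions. -/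
def Entails (S : DefaultSemantics) (T : DefaultTheory) (φ : Formula) : Prop :=
  ∀ E : Set Formula, S.IsExtension T E → φ ∈ E

end DefaultSemantics

/-! ## Time bounds -/

/-! Under the promise a single extension decides the question: every extension is consistent, so one
that contains `a` rules out the alternative that all of them contain the negation of `a`. It remains
to compute one extension in polynomial time with an NP oracle.

Extend the empty process greedily by any default that leaves it a successful process. When none
fits, the process is closed: by fail-safety it is a prefix of a successful closed process, and if
that prefix were proper, antimonotonicity would make the first additional default appendable
(`closed_greedySequence`). A default rejected once may fit later, when its precondition has become
derivable, so all defaults are tried in as many rounds as there are defaults; a round without growth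
is final, and growth in every round exhausts the defaults (`greedySequence_maximal`). Each attempt
needs polynomially many satisfiability queries.

For the complexity bound, `FP` collects the oracle-computable functions on all trees. It is closed
under composition, case distinction, queries and, by `FP.treeRec`, recursion on trees with
polynomially bounded values, so the procedure can be written as recursive functions instead of
programs. The oracle `satSet` is in NP and answers consistency tests (`code_mem_satSet`). The
programs given by regularity are controlled only on codes; `PolyTime.exists_FP` guards them by a
recognizer. -/

theorem polynomial_eval_mono (q : Polynomial ℕ) : Monotone fun n => q.eval n := by
  intro m n h
  simp only [Polynomial.eval_eq_sum, Polynomial.sum]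
  exact Finset.sum_le_sum fun i _ => Nat.mul_le_mul_left _ (Nat.pow_le_pow_left h i)

namespace Data

theorem size_pos (x : Data) : 0 < x.size := by
  cases x <;> simp only [size] <;> omega

theorem size_head_le (x : Data) : x.head.size ≤ x.size := by
  cases x <;> simp only [size, head] <;> omega

theorem size_tail_le (x : Data) : x.tail.size ≤ x.size := by
  cases x <;> simp only [size, tail] <;> omega

/-- Case distinction on whether the first argument is the leaf. -/
def ite : Data → Data → Data → Data
  | nil, _, z => z
  | cons _ _, y, _ => y

theorem ite_nil (y z : Data) : ite nil y z = z := rfl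

theorem ite_of_ne {x : Data} (h : x ≠ nil) (y z : Data) : ite x y z = y := by
  cases x
  · exact absurd rfl h
  · rfl

theorem size_ite_le (x y z : Data) : (ite x y z).size ≤ max y.size z.size := by
  cases x <;> simp [ite]

open Classical in
/-- The answer of the oracle `A`. -/
noncomputable def query (A : Set Data) (x : Data) : Data := boolData (decide (x ∈ A))

end Data

theorem size_boolData_le (b : Bool) : (boolData b).size ≤ 3 := by
  cases b <;> simp [boolData, Data.size]

/-- Elementary operations are charged for the size of the store, so a time bound is also a bound on
the output. This is what makes composition polynomial. -/
theorem Run.size_le {A : Set Data} {p : Program} {x y : Data} {t : ℕ} (h : Run A p x y t) :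
    x.size ≤ t ∧ y.size ≤ t := by
  induction h with
  | clear x => have := x.size_pos; simp only [Data.size]; omega
  | head x => have := x.size_head_le; omega
  | tail x => have := x.size_tail_le; omega
  | pair _ _ h₁ h₂ => simp only [Data.size]; omega
  | @query_yes x h => have := x.size_pos; simp only [Data.size, boolData]; omega
  | @query_no x h => have := x.size_pos; simp only [Data.size, boolData]; omega
  | _ => omega

/-- The program with all queries replaced by the answer "no". -/
def Program.unquery : Program → Program
  | pair p q => pair p.unquery q.unquery
  | seq p q => seq p.unquery q.unquery
  | cond b p q => cond b.unquery p.unquery q.unquery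
  | loop b p => loop b.unquery p.unquery
  | query => clear
  | p => p

/-- The empty oracle always answers with the leaf, which `clear` also returns, one step cheaper.
Oracle-free computations thereby survive a change of oracle. -/
theorem Run.unquery {p : Program} {x y : Data} {t : ℕ} (A : Set Data) (h : Run ∅ p x y t) :
    ∃ u ≤ t, Run A p.unquery x y u := by
  induction h with
  | skip x => exact ⟨_, le_rfl, .skip x⟩
  | clear x => exact ⟨_, le_rfl, .clear x⟩
  | head x => exact ⟨_, le_rfl, .head x⟩
  | tail x => exact ⟨_, le_rfl, .tail x⟩
  | pair _ _ h₁ h₂ =>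
    obtain ⟨u, hu, h₁⟩ := h₁
    obtain ⟨v, hv, h₂⟩ := h₂
    exact ⟨_, by omega, .pair h₁ h₂⟩
  | seq _ _ h₁ h₂ =>
    obtain ⟨u, hu, h₁⟩ := h₁
    obtain ⟨v, hv, h₂⟩ := h₂
    exact ⟨_, by omega, .seq h₁ h₂⟩
  | cond_then _ _ h₁ h₂ =>
    obtain ⟨u, hu, h₁⟩ := h₁
    obtain ⟨v, hv, h₂⟩ := h₂
    exact ⟨_, by omega, .cond_then h₁ h₂⟩
  | cond_else _ _ h₁ h₂ =>
    obtain ⟨u, hu, h₁⟩ := h₁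
    obtain ⟨v, hv, h₂⟩ := h₂
    exact ⟨_, by omega, .cond_else h₁ h₂⟩
  | loop_exit _ h₁ =>
    obtain ⟨u, hu, h₁⟩ := h₁
    exact ⟨_, by omega, .loop_exit h₁⟩
  | loop_next _ _ _ h₁ h₂ h₃ =>
    obtain ⟨u, hu, h₁⟩ := h₁
    obtain ⟨v, hv, h₂⟩ := h₂
    obtain ⟨w, hw, h₃⟩ := h₃
    exact ⟨_, by omega, .loop_next h₁ h₂ h₃⟩
  | query_yes h => exact absurd h (Set.notMem_empty _)
  | @query_no x h => exact ⟨_, by omega, .clear x⟩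

/-! ## Functions on trees that are computable in polynomial time -/

/-- `f` is computed in polynomial time, on all trees, with oracle set `A`. -/
def FP (A : Set Data) (f : Data → Data) : Prop :=
  ∃ (p : Program) (q : Polynomial ℕ), ∀ x : Data, ∃ t ≤ q.eval x.size, Run A p x (f x) t

namespace FP

variable {A : Set Data} {f g h : Data → Data}

theorem id : FP A fun x => x :=
  ⟨.skip, 1 + .X, fun x => ⟨_, by simp, .skip x⟩⟩

theorem nil : FP A fun _ => .nil :=
  ⟨.clear, 1 + .X, fun x => ⟨_, by simp, .clear x⟩⟩

theorem comp (hg : FP A g) (hf : FP A f) : FP A fun x => g (f x) := by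
  obtain ⟨p, q, hp⟩ := hf
  obtain ⟨p', q', hp'⟩ := hg
  refine ⟨.seq p p', 1 + q + q'.comp q, fun x => ?_⟩
  obtain ⟨s, hs, hr⟩ := hp x
  obtain ⟨t, ht, hr'⟩ := hp' (f x)
  refine ⟨_, ?_, .seq hr hr'⟩
  have := polynomial_eval_mono q' (hr.size_le.2.trans hs)
  simp only [Polynomial.eval_add, Polynomial.eval_one, Polynomial.eval_comp] at this ⊢
  omega

theorem head (hf : FP A f) : FP A fun x => (f x).head :=
  comp ⟨.head, 1 + .X, fun x => ⟨_, by simp, .head x⟩⟩ hf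

theorem tail (hf : FP A f) : FP A fun x => (f x).tail :=
  comp ⟨.tail, 1 + .X, fun x => ⟨_, by simp, .tail x⟩⟩ hf

theorem cons (hf : FP A f) (hg : FP A g) : FP A fun x => .cons (f x) (g x) := by
  obtain ⟨p, q, hp⟩ := hf
  obtain ⟨p', q', hp'⟩ := hg
  refine ⟨.pair p p', 1 + q + q', fun x => ?_⟩
  obtain ⟨s, hs, hr⟩ := hp x
  obtain ⟨t, ht, hr'⟩ := hp' x
  exact ⟨_, by simp; omega, .pair hr hr'⟩

theorem ite (hf : FP A f) (hg : FP A g) (hh : FP A h) :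
    FP A fun x => Data.ite (f x) (g x) (h x) := by
  obtain ⟨b, q, hb⟩ := hf
  obtain ⟨p, q₁, hp⟩ := hg
  obtain ⟨p', q₂, hp'⟩ := hh
  refine ⟨.cond b p p', 1 + q + q₁ + q₂, fun x => ?_⟩
  obtain ⟨s, hs, hr⟩ := hb x
  obtain ⟨t₁, ht₁, hr₁⟩ := hp x
  obtain ⟨t₂, ht₂, hr₂⟩ := hp' x
  rcases hc : f x with _ | ⟨l, r⟩
  · rw [hc] at hr
    refine ⟨1 + s + t₂, by simp; omega, ?_⟩
    simp only [hc]
    exact .cond_else hr hr₂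
  · rw [hc] at hr
    refine ⟨1 + s + t₁, by simp; omega, ?_⟩
    simp only [hc]
    exact .cond_then hr hr₁

theorem query (hf : FP A f) : FP A fun x => Data.query A (f x) := by
  refine comp (g := Data.query A) ⟨.query, 2 + .X, fun x => ?_⟩ hf
  refine ⟨2 + x.size, by simp, ?_⟩
  by_cases hx : x ∈ A
  · simpa [Data.query, hx] using Run.query_yes hx
  · simpa [Data.query, hx] using Run.query_no hx

theorem const (c : Data) : FP A fun _ => c := by
  induction c with
  | nil => exact nil
  | cons l r hl hr => exact cons hl hr

/-- Functions of two arguments that may be applied to polynomial-time computable arguments. -/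
theorem comp₂ {F : Data → Data → Data} (hF : FP A fun z => F z.head z.tail)
    (hf : FP A f) (hg : FP A g) : FP A fun x => F (f x) (g x) :=
  comp hF (cons hf hg)

end FP

/-- `Steps b s M k x y`: from `x`, after `k` iterations of `s`, we arrive at `y`; before each of
them the test `b` is positive and the size is at most `M`. -/
inductive Steps (b s : Data → Data) (M : ℕ) : ℕ → Data → Data → Prop
  | refl (x : Data) : Steps b s M 0 x x
  | step {k : ℕ} {x y : Data} : b x ≠ Data.nil → x.size ≤ M → Steps b s M k (s x) y →
      Steps b s M (k + 1) x y

theorem Steps.trans {b s : Data → Data} {M k l : ℕ} {x y z : Data} (h : Steps b s M k x y)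
    (h' : Steps b s M l y z) : Steps b s M (k + l) x z := by
  induction h with
  | refl x => simpa using h'
  | step hb hM _ ih => rw [Nat.add_right_comm]; exact .step hb hM (ih h')

/-- Sizes stay below `M`, so one iteration costs at most `1 + q(M) + q'(M)`; the factor `k + 1`
accounts for the final, failing test. -/
theorem FP.loop {A : Set Data} {i b s F : Data → Data} (hi : FP A i) (hb : FP A b)
    (hs : FP A s) (N M : Polynomial ℕ)
    (h : ∀ x, (∃ k ≤ N.eval x.size, Steps b s (M.eval x.size) k (i x) (F x)) ∧ b (F x) = Data.nil ∧
      (F x).size ≤ M.eval x.size) : FP A F := by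
  obtain ⟨p, q, hp⟩ := hb
  obtain ⟨p', q', hp'⟩ := hs
  have key : ∀ M k x y, Steps b s M k x y → b y = Data.nil → y.size ≤ M →
      ∃ t ≤ (k + 1) * (1 + q.eval M + q'.eval M), Run A (.loop p p') x y t := by
    intro M k x y h
    induction h with
    | refl x =>
      intro hy hM
      obtain ⟨t, ht, hr⟩ := hp x
      have := polynomial_eval_mono q hM
      rw [hy] at hr
      exact ⟨_, by simp only at this; omega, .loop_exit hr⟩
    | @step k x y hx hM _ ih =>
      intro hy hM'
      obtain ⟨t, ht, hr⟩ := hp x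
      obtain ⟨t', ht', hr'⟩ := hp' x
      obtain ⟨u, hu, hl⟩ := ih hy hM'
      have h₁ := polynomial_eval_mono q hM
      have h₂ := polynomial_eval_mono q' hM
      rcases hc : b x with _ | ⟨l, r⟩
      · exact absurd hc hx
      rw [hc] at hr
      refine ⟨_, ?_, .loop_next hr hr' hl⟩
      rw [Nat.add_mul (k + 1)]
      simp only at h₁ h₂
      omega
  obtain ⟨pi, qi, hpi⟩ := hi
  refine ⟨.seq pi (.loop p p'), 1 + qi + (N + 1) * (1 + q.comp M + q'.comp M), fun x => ?_⟩
  obtain ⟨⟨k, hk, h₁⟩, h₂, h₃⟩ := h x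
  obtain ⟨u, hu, hi⟩ := hpi x
  obtain ⟨t, ht, hr⟩ := key _ _ _ _ h₁ h₂ h₃
  refine ⟨1 + u + t, ?_, .seq hi hr⟩
  simp only [Polynomial.eval_mul, Polynomial.eval_add, Polynomial.eval_one, Polynomial.eval_comp]
  refine Nat.add_le_add (Nat.add_le_add_left hu _) (ht.trans ?_)
  gcongr

/-! ### Recursion on trees -/

section TreeRec

variable (base pl pr : Data → Data) (g : Data → Data → Data → Data → Data → Data)

/-- One step of the stack machine that evaluates a function defined by recursion on trees.  The
state consists of a stack of tasks and a stack of values. -/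
def treeRecStep (σ : Data) : Data :=
  let p := σ.head.head.tail.head
  let t := σ.head.head.tail.tail
  -- A task is tagged: the leaf means "evaluate", anything else "combine". The right subtree is
  -- evaluated last, so its value lies on top of that of the left one.
  Data.ite σ.head.head.head
    (.cons σ.head.tail
      (.cons (g p t.head t.tail σ.tail.tail.head σ.tail.head) σ.tail.tail.tail))
    (Data.ite t
      (.cons (.cons (.cons .nil (.cons (pl p) t.head))
          (.cons (.cons .nil (.cons (pr p) t.tail))
            (.cons (.cons (.cons .nil .nil) (.cons p t)) σ.head.tail)))
        σ.tail)
      (.cons σ.head.tail (.cons (base p) σ.tail)))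

variable {base pl pr g}

/-- Induction with arbitrary stacks below the current task. Each node of `t` is allotted `β + 6 * n
+ 30` units of memory, enough for one value and the pending tasks it creates, and at most two
iterations (expand and combine). -/
theorem steps_treeRec {f : Data → Data → Data} (hnil : ∀ p, f p .nil = base p)
    (hcons : ∀ p l r, f p (.cons l r) = g p l r (f (pl p) l) (f (pr p) r))
    (hpl : ∀ p, (pl p).size ≤ p.size) (hpr : ∀ p, (pr p).size ≤ p.size) (n β M : ℕ)
    (hβ : ∀ p t : Data, p.size ≤ n → t.size ≤ n → (f p t).size ≤ β) (t : Data) :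
    ∀ p items vals : Data, p.size ≤ n → t.size ≤ n →
      items.size + vals.size + t.size * (β + 6 * n + 30) ≤ M →
      ∃ k ≤ 2 * t.size, Steps Data.head (treeRecStep base pl pr g) M k
        (.cons (.cons (.cons .nil (.cons p t)) items) vals) (.cons items (.cons (f p t) vals)) := by
  induction t with
  | nil =>
    intro p items vals hp ht hM
    refine ⟨1, by simp [Data.size], .step (by simp [Data.head]) ?_ ?_⟩
    · simp only [Data.size] at hM ⊢; omega
    · rw [hnil]; exact .refl _
  | cons l r ihl ihr =>
    intro p items vals hp ht hM
    have hl := l.size_pos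
    have hr := r.size_pos
    simp only [Data.size] at ht hM
    have h₁ := hβ _ _ ((hpl p).trans hp) (show l.size ≤ n by omega)
    have h₂ := hβ _ _ ((hpr p).trans hp) (show r.size ≤ n by omega)
    have e₁ := hpl p
    have e₂ := hpr p
    have e : (1 + l.size + r.size) * (β + 6 * n + 30) = (β + 6 * n + 30) +
      l.size * (β + 6 * n + 30) + r.size * (β + 6 * n + 30) := by ring
    have el : β + 6 * n + 30 ≤ l.size * (β + 6 * n + 30) := Nat.le_mul_of_pos_left _ hl
    have er : β + 6 * n + 30 ≤ r.size * (β + 6 * n + 30) := Nat.le_mul_of_pos_left _ hr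
    obtain ⟨k₁, hk₁, s₁⟩ := ihl (pl p) (.cons (.cons .nil (.cons (pr p) r))
      (.cons (.cons (.cons .nil .nil) (.cons p (.cons l r))) items)) vals
      (by omega) (by omega) (by simp only [Data.size]; omega)
    obtain ⟨k₂, hk₂, s₂⟩ := ihr (pr p)
      (.cons (.cons (.cons .nil .nil) (.cons p (.cons l r))) items) (.cons (f (pl p) l) vals)
      (by omega) (by omega) (by simp only [Data.size]; omega)
    refine ⟨k₁ + (k₂ + 1) + 1, by simp only [Data.size]; omega,
      .step (by simp [Data.head]) (by simp only [Data.size]; omega)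
        (s₁.trans (s₂.trans (.step (by simp [Data.head]) ?_ ?_)))⟩
    · simp only [Data.size]; omega
    · rw [hcons]; exact .refl _

end TreeRec

/-- Recursion on trees, with a parameter that may be changed (but not enlarged) in the recursive
calls, leads to a polynomial-time computable function if the size of the values is polynomially
bounded. -/
theorem FP.treeRec {A : Set Data} {base pl pr : Data → Data}
    {g : Data → Data → Data → Data → Data → Data} {f : Data → Data → Data}
    (hnil : ∀ p, f p .nil = base p)
    (hcons : ∀ p l r, f p (.cons l r) = g p l r (f (pl p) l) (f (pr p) r))
    (hb : FP A base) (hl : FP A pl) (hr : FP A pr)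
    (hg : ∀ a b c d e : Data → Data, FP A a → FP A b → FP A c → FP A d → FP A e →
      FP A fun x => g (a x) (b x) (c x) (d x) (e x))
    (hpl : ∀ p, (pl p).size ≤ p.size) (hpr : ∀ p, (pr p).size ≤ p.size)
    (B : Polynomial ℕ) (hB : ∀ p t, (f p t).size ≤ B.eval (p.size + t.size))
    {u v : Data → Data} (hu : FP A u) (hv : FP A v) : FP A fun z => f (u z) (v z) := by
  refine FP.comp₂ (F := f) ?_ hu hv
  have hs : FP A (treeRecStep base pl pr g) :=
    .ite id.head.head.head
      (.cons id.head.tail (.cons (hg _ _ _ _ _ id.head.head.tail.head id.head.head.tail.tail.head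
        id.head.head.tail.tail.tail id.tail.tail.head id.tail.head) id.tail.tail.tail))
      (.ite id.head.head.tail.tail
        (.cons (.cons (.cons nil (.cons (hl.comp id.head.head.tail.head) id.head.head.tail.tail.head))
          (.cons (.cons nil (.cons (hr.comp id.head.head.tail.head) id.head.head.tail.tail.tail))
            (.cons (.cons (const _) (.cons id.head.head.tail.head id.head.head.tail.tail))
              id.head.tail))) id.tail)
        (.cons id.head.tail (.cons (hb.comp id.head.head.tail.head) id.tail)))
  have hi : FP A fun z => .cons (.cons (.cons .nil z) .nil) .nil :=
    .cons (.cons (.cons nil id) nil) nil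
  have := FP.loop (F := fun z => .cons .nil (.cons (f z.head z.tail) .nil)) hi (head id) hs
    (2 * .X) (2 * B.comp (2 * .X) + 10 + 2 * .X * (B.comp (2 * .X) + 6 * .X + 30)) fun z => ?_
  · exact this.tail.head
  have h₁ := z.size_head_le
  have h₂ := z.size_tail_le
  -- The factor 2 arises because parameter and argument are each bounded only by the whole input
  -- `z`.
  have hβ : ∀ p t : Data, p.size ≤ z.size → t.size ≤ z.size →
      (f p t).size ≤ B.eval (2 * z.size) := fun p t hp ht =>
    (hB p t).trans (polynomial_eval_mono B (by omega))
  simp only [Polynomial.eval_add, Polynomial.eval_mul, Polynomial.eval_comp, Polynomial.eval_X,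
    Polynomial.eval_ofNat]
  set M := 2 * B.eval (2 * z.size) + 10 + 2 * z.size * (B.eval (2 * z.size) + 6 * z.size + 30)
    with hM
  have hz := hβ _ _ h₁ h₂
  refine ⟨?_, rfl, by simp only [Data.size]; omega⟩
  -- The leaf is not a pair, but its head and tail are leaves, so the machine evaluates the base
  -- case on it at once.
  rcases z with _ | ⟨p, t⟩
  · refine ⟨1, by simp [Data.size], .step (by simp [Data.head]) ?_ ?_⟩
    · simp only [Data.size] at hM ⊢; omega
    · simp only [Data.head, Data.tail, hnil]; exact .refl _
  · have hM' : Data.nil.size + Data.nil.size +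
        t.size * (B.eval (2 * (Data.cons p t).size) + 6 * (Data.cons p t).size + 30) ≤ M := by
      have := Nat.mul_le_mul_right
        (B.eval (2 * (Data.cons p t).size) + 6 * (Data.cons p t).size + 30) h₂
      simp only [Data.tail] at this
      rw [hM, Nat.mul_assoc 2 (Data.cons p t).size]
      simp only [Data.size] at this ⊢
      omega
    obtain ⟨k, hk, h⟩ := steps_treeRec hnil hcons hpl hpr (Data.cons p t).size _ M hβ t p .nil .nil
      h₁ h₂ hM'
    exact ⟨k, hk.trans (Nat.mul_le_mul_left _ h₂), h⟩

/-- Recursion along the right spine is tree recursion that discards the value on the left part. That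
value is computed nevertheless, so the size bound is required on all trees. -/
theorem FP.fold {A : Set Data} {base : Data → Data} {g : Data → Data → Data → Data → Data}
    {f : Data → Data → Data} (hnil : ∀ p, f p .nil = base p)
    (hcons : ∀ p a r, f p (.cons a r) = g p a r (f p r)) (hb : FP A base)
    (hg : ∀ a b c d : Data → Data, FP A a → FP A b → FP A c → FP A d →
      FP A fun x => g (a x) (b x) (c x) (d x))
    (B : Polynomial ℕ) (hB : ∀ p t, (f p t).size ≤ B.eval (p.size + t.size))
    {u v : Data → Data} (hu : FP A u) (hv : FP A v) : FP A fun z => f (u z) (v z) :=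
  FP.treeRec (pl := fun p => p) (pr := fun p => p) (g := fun p a r _ w => g p a r w) hnil hcons hb
    .id .id (fun _ _ _ _ _ ha hb hc _ he => hg _ _ _ _ ha hb hc he) (fun _ => le_rfl)
    (fun _ => le_rfl) B hB hu hv

/-- Recursion in which the right part of a tree, and both parts of that, may be used. -/
theorem FP.deepRec {A : Set Data} {base : Data → Data}
    {g : Data → Data → Data → Data → Data → Data → Data}
    {f : Data → Data → Data} (hnil : ∀ p, f p .nil = base p)
    (hcons : ∀ p l r, f p (.cons l r) = g p l r (f p r) (f p r.head) (f p r.tail)) (hb : FP A base)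
    (hg : ∀ a b c d e e' : Data → Data, FP A a → FP A b → FP A c → FP A d → FP A e → FP A e' →
      FP A fun x => g (a x) (b x) (c x) (d x) (e x) (e' x))
    (c : ℕ) (hB : ∀ p t, (f p t).size ≤ c)
    {u v : Data → Data} (hu : FP A u) (hv : FP A v) : FP A fun z => f (u z) (v z) := by
  -- The recursion carries the values on the tree and on both its parts, so that the grandchildren's
  -- values are at hand one level higher.
  refine head (f := fun z => .cons (f (u z) (v z)) (.cons (f (u z) (v z).head) (f (u z) (v z).tail)))
    (FP.treeRec (f := fun p t => .cons (f p t) (.cons (f p t.head) (f p t.tail)))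
    (base := fun p => .cons (base p) (.cons (base p) (base p)))
    (pl := fun p => p) (pr := fun p => p)
    (g := fun p l r vl vr => .cons (g p l r vr.head vr.tail.head vr.tail.tail)
      (.cons vl.head vr.head)) ?_ ?_ (hb.cons (hb.cons hb)) .id .id ?_ (fun _ => le_rfl)
      (fun _ => le_rfl) (3 * (c : Polynomial ℕ) + 2) ?_ hu hv)
  · intro p
    simp only [Data.head, Data.tail, hnil]
  · intro p l r
    simp only [Data.head, Data.tail, hcons]
  · intro a b c d e ha hb hc hd he
    exact (hg _ _ _ _ _ _ ha hb hc he.head he.tail.head he.tail.tail).cons (hd.head.cons he.head)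
  · intro p t
    have h₁ := hB p t
    have h₂ := hB p t.head
    have h₃ := hB p t.tail
    simp only [Data.size, Polynomial.eval_add, Polynomial.eval_mul, Polynomial.eval_natCast,
      Polynomial.eval_ofNat]
    simp only [Nat.cast_id]
    omega

theorem FP.mem_classP {A : Set Data} {f : Data → Data} (hf : FP A f) :
    {x | f x ≠ .nil} ∈ classP A := by
  obtain ⟨p, q, hp⟩ := hf.ite (const (boolData true)) (const (boolData false))
  refine ⟨p, q, fun x => ?_⟩
  obtain ⟨t, ht, hr⟩ := hp x
  refine ⟨t, ht, fun hx => ?_, fun hx => ?_⟩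
  · simpa only [Data.ite_of_ne hx] using hr
  · simpa only [not_not.1 hx, Data.ite_nil] using hr

/-! ### Equality and list membership as polynomial-time tests -/

namespace Data

theorem boolData_ne_nil (b : Bool) : boolData b ≠ nil ↔ b = true := by
  cases b <;> simp [boolData]

theorem ite_ne_nil (x y : Data) : ite x y nil ≠ nil ↔ x ≠ nil ∧ y ≠ nil := by
  cases x <;> simp [ite]

/-- Equality test. -/
def eq (y : Data) : Data → Data
  | nil => ite y nil (boolData true)
  | cons l r => ite y (ite (eq y.head l) (eq y.tail r) nil) nil

theorem eq_ne_nil (x y : Data) : eq y x ≠ nil ↔ y = x := by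
  induction x generalizing y with
  | nil => cases y <;> simp [eq, ite, boolData]
  | cons l r hl hr =>
    rw [eq, ite_ne_nil, ite_ne_nil, hl, hr]
    cases y <;> simp [head, tail]

theorem size_eq_le (y x : Data) : (eq y x).size ≤ 3 := by
  induction x generalizing y with
  | nil => cases y <;> simp [eq, ite, boolData, size]
  | cons l r hl hr =>
    refine (size_ite_le _ _ _).trans (max_le ((size_ite_le _ _ _).trans (max_le (hr _) ?_)) ?_) <;>
      simp [size]

/-- Membership in a list. -/
def mem (y : Data) : Data → Data
  | nil => nil
  | cons a r => ite (eq y a) (boolData true) (mem y r)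

theorem size_mem_le (y x : Data) : (mem y x).size ≤ 3 := by
  induction x with
  | nil => simp [mem, size]
  | cons l r _ hr =>
    exact (size_ite_le _ _ _).trans (max_le (size_boolData_le _) hr)

theorem mem_listData_ne_nil {α : Type} [TreeCode α] (y : Data) (l : List α) :
    mem y (listData l) ≠ nil ↔ ∃ a ∈ l, y = TreeCode.code a := by
  induction l with
  | nil => simp [listData, mem]
  | cons a l ih =>
    rw [listData, mem]
    by_cases h : y = TreeCode.code a
    · rw [ite_of_ne ((eq_ne_nil _ _).2 h)]
      simp [h, boolData]
    · rw [not_not.1 (mt (eq_ne_nil _ _).1 h), ite_nil, ih]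
      simp [h]

end Data

theorem FP.eq {A : Set Data} {f g : Data → Data} (hf : FP A f) (hg : FP A g) :
    FP A fun x => Data.eq (f x) (g x) :=
  treeRec (f := Data.eq) (fun _ => rfl) (fun _ _ _ => rfl) (.ite id nil (const _)) (head id)
    (tail id) (g := fun p _ _ v w => Data.ite p (Data.ite v w .nil) .nil)
    (fun _ _ _ _ _ ha _ _ hd he => .ite ha (.ite hd he nil) nil)
    Data.size_head_le Data.size_tail_le 3 (fun y x => by simpa using Data.size_eq_le y x) hf hg

theorem FP.mem {A : Set Data} {f g : Data → Data} (hf : FP A f) (hg : FP A g) :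
    FP A fun x => Data.mem (f x) (g x) :=
  fold (f := Data.mem) (fun _ => rfl) (fun _ _ _ => rfl) nil
    (g := fun y a _ w => Data.ite (Data.eq y a) (boolData true) w)
    (fun _ _ _ _ ha hb _ hd => .ite (.eq ha hb) (const _) hd)
    3 (fun y x => by simpa using Data.size_mem_le y x) hf hg

/-! ## Codes -/

theorem boolData_injective : Function.Injective boolData := by
  intro a b h
  cases a <;> cases b <;> simp_all [boolData]

theorem listData_injective {α : Type} [TreeCode α]
    (h : Function.Injective (TreeCode.code : α → Data)) :
    Function.Injective (TreeCode.code : List α → Data) := by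
  intro l
  induction l with
  | nil =>
    rintro (_ | ⟨b, m⟩) e
    · rfl
    · exact Data.noConfusion e
  | cons a l ih =>
    rintro (_ | ⟨b, m⟩) e
    · exact Data.noConfusion e
    · obtain ⟨e₁, e₂⟩ := Data.cons.inj e
      rw [h e₁, ih e₂]

theorem prodCode_injective {α β : Type} [TreeCode α] [TreeCode β]
    (h : Function.Injective (TreeCode.code : α → Data))
    (h' : Function.Injective (TreeCode.code : β → Data)) :
    Function.Injective (TreeCode.code : α × β → Data) := by
  rintro ⟨a, b⟩ ⟨c, d⟩ e
  obtain ⟨e₁, e₂⟩ := Data.cons.inj e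
  exact Prod.ext (h e₁) (h' e₂)

theorem Formula.toData_injective : Function.Injective Formula.toData := by
  intro φ
  have hv := listData_injective boolData_injective
  induction φ with
  | var n => rintro (_ | _ | _ | _ | _) e <;> simp [toData] at e ⊢; exact hv e
  | bot => rintro (_ | _ | _ | _ | _) e <;> simp [toData] at e ⊢
  | neg φ ih => rintro (_ | _ | _ | _ | _) e <;> simp [toData] at e ⊢; exact ih e
  | and φ ψ ih ih' =>
    rintro (_ | _ | _ | _ | _) e <;> simp [toData] at e ⊢; exact ⟨ih e.1, ih' e.2⟩
  | or φ ψ ih ih' =>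
    rintro (_ | _ | _ | _ | _) e <;> simp [toData] at e ⊢; exact ⟨ih e.1, ih' e.2⟩

theorem Default.code_injective : Function.Injective (TreeCode.code : Default → Data) := by
  rintro ⟨a, b, c⟩ ⟨a', b', c'⟩ e
  have hf := Formula.toData_injective
  obtain ⟨rfl, e⟩ := Prod.mk.inj (prodCode_injective hf (prodCode_injective hf hf) e)
  obtain ⟨rfl, rfl⟩ := Prod.mk.inj e
  rfl

theorem Presentation.code_injective : Function.Injective (TreeCode.code : Presentation → Data) := by
  rintro ⟨a, b, c⟩ ⟨a', b', c'⟩ e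
  obtain ⟨rfl, rfl⟩ := Prod.mk.inj (prodCode_injective (listData_injective Default.code_injective)
    (listData_injective Formula.toData_injective) e)
  rfl

theorem presentationList_code_injective :
    Function.Injective (TreeCode.code : Presentation × List Default → Data) :=
  prodCode_injective Presentation.code_injective (listData_injective Default.code_injective)

/-- The codes of the elements of `α` can be recognized in polynomial time. -/
def Recognizable (A : Set Data) (α : Type) [TreeCode α] : Prop :=
  ∃ V : Data → Data, FP A V ∧ ∀ x, V x ≠ .nil ↔ ∃ a : α, TreeCode.code a = x

/-- A function that is computable in polynomial time on the codes of a recognizable type can be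
extended to all trees. -/
theorem PolyTime.exists_FP {α β : Type} [TreeCode α] [TreeCode β] {f : α → β} (hf : PolyTime f)
    {A : Set Data} (hr : Recognizable A α) (hi : Function.Injective (TreeCode.code : α → Data)) :
    ∃ F, FP A F ∧ ∀ a : α, F (TreeCode.code a) = TreeCode.code (f a) := by
  classical
  obtain ⟨V, ⟨b, q, hb⟩, hV⟩ := hr
  obtain ⟨p, q', hp⟩ := hf
  -- Off the codes the value is the leaf. On them the chosen preimage is the right one by
  -- injectivity.
  set F : Data → Data := fun x => if h : ∃ a : α, TreeCode.code a = x then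
    TreeCode.code (f h.choose) else .nil
  have hF : ∀ a : α, F (TreeCode.code a) = TreeCode.code (f a) := by
    intro a
    have h : ∃ a' : α, TreeCode.code a' = TreeCode.code a := ⟨a, rfl⟩
    simp only [F, dif_pos h, hi h.choose_spec]
  -- The recognizer runs first because `p` need not halt on trees that are no codes.
  refine ⟨F, ⟨.cond b p.unquery .clear, 2 + q + q' + .X, fun x => ?_⟩, hF⟩
  obtain ⟨t, ht, hr⟩ := hb x
  rcases hc : V x with _ | ⟨l, r⟩
  · rw [hc] at hr
    have h : ¬ ∃ a : α, TreeCode.code a = x := fun h => (hV x).2 h hc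
    refine ⟨1 + t + (1 + x.size), by simp; omega, ?_⟩
    simp only [F, dif_neg h]
    exact .cond_else hr (.clear x)
  · rw [hc] at hr
    obtain ⟨a, rfl⟩ := (hV x).1 (by rw [hc]; exact Data.noConfusion)
    obtain ⟨u, hu, hr'⟩ := hp a
    obtain ⟨u', hu', hr'⟩ := hr'.unquery A
    refine ⟨1 + t + u', by simp; omega, ?_⟩
    rw [hF]
    exact .cond_then hr hr'

/-- Recognition of truth values. -/
def Data.isBool (x : Data) : Data := ite x (eq x (boolData true)) (boolData true)

theorem Data.isBool_ne_nil (x : Data) : isBool x ≠ nil ↔ ∃ b : Bool, TreeCode.code b = x := by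
  rcases x with _ | ⟨l, r⟩
  · exact ⟨fun _ => ⟨false, rfl⟩, fun _ => Data.noConfusion⟩
  · change eq _ _ ≠ _ ↔ _
    rw [eq_ne_nil]
    refine ⟨fun h => ⟨true, h.symm⟩, ?_⟩
    rintro ⟨_ | _, h⟩
    · exact Data.noConfusion h
    · exact h.symm

theorem FP.isBool {A : Set Data} {f : Data → Data} (hf : FP A f) :
    FP A fun x => Data.isBool (f x) :=
  .ite hf (.eq hf (const _)) (const _)

theorem recognizable_bool (A : Set Data) : Recognizable A Bool :=
  ⟨Data.isBool, .isBool .id, Data.isBool_ne_nil⟩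

theorem Recognizable.prod {A : Set Data} {α β : Type} [TreeCode α] [TreeCode β]
    (h : Recognizable A α) (h' : Recognizable A β) : Recognizable A (α × β) := by
  obtain ⟨V, hV, h⟩ := h
  obtain ⟨V', hV', h'⟩ := h'
  refine ⟨fun x => .ite x (.ite (V x.head) (V' x.tail) .nil) .nil,
    .ite .id (.ite (hV.comp (.head .id)) (hV'.comp (.tail .id)) .nil) .nil, fun x => ?_⟩
  rw [Data.ite_ne_nil, Data.ite_ne_nil, h, h']
  constructor
  · rintro ⟨hx, ⟨a, ha⟩, ⟨b, hb⟩⟩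
    rcases x with _ | ⟨l, r⟩
    · exact absurd rfl hx
    · exact ⟨(a, b), congrArg₂ Data.cons ha hb⟩
  · rintro ⟨⟨a, b⟩, rfl⟩
    exact ⟨Data.noConfusion, ⟨a, rfl⟩, ⟨b, rfl⟩⟩

/-- `allList V x` is positive if `V` is positive on all members of the list `x`. -/
def Data.allList (V : Data → Data) : Data → Data
  | nil => boolData true
  | cons a r => ite (V a) (allList V r) nil

theorem Data.size_allList_le (V : Data → Data) (x : Data) : (allList V x).size ≤ 3 := by
  induction x with
  | nil => exact size_boolData_le _
  | cons a r _ ih => exact (size_ite_le _ _ _).trans (max_le ih (by simp [size]))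

theorem Data.allList_ne_nil {α : Type} [TreeCode α] {V : Data → Data}
    (hV : ∀ x, V x ≠ .nil ↔ ∃ a : α, TreeCode.code a = x) (x : Data) :
    allList V x ≠ .nil ↔ ∃ l : List α, listData l = x := by
  induction x with
  | nil => exact ⟨fun _ => ⟨[], rfl⟩, fun _ => Data.noConfusion⟩
  | cons a r _ ih =>
    rw [allList, ite_ne_nil, ih, hV]
    constructor
    · rintro ⟨⟨a, rfl⟩, ⟨l, rfl⟩⟩
      exact ⟨a :: l, rfl⟩
    · rintro ⟨_ | ⟨b, l⟩, h⟩
      · exact Data.noConfusion h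
      · obtain ⟨h₁, h₂⟩ := cons.inj h
        exact ⟨⟨b, h₁⟩, ⟨l, h₂⟩⟩

theorem FP.allList {A : Set Data} {V f : Data → Data} (hV : FP A V) (hf : FP A f) :
    FP A fun x => Data.allList V (f x) :=
  fold (f := fun _ => Data.allList V) (fun _ => rfl) (fun _ _ _ => rfl) (const _)
    (g := fun _ a _ w => Data.ite (V a) w .nil)
    (fun _ _ _ _ _ hb _ hd => .ite (hV.comp hb) hd nil)
    3 (fun _ x => by simpa using Data.size_allList_le V x) nil hf

theorem Recognizable.list {A : Set Data} {α : Type} [TreeCode α] (h : Recognizable A α) :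
    Recognizable A (List α) := by
  obtain ⟨V, hV, h⟩ := h
  exact ⟨Data.allList V, .allList hV .id, Data.allList_ne_nil h⟩

/-! ## Satisfiability -/

namespace Data

/-- Recognition of words over the two-letter alphabet. -/
def word : Data → Data := allList isBool

theorem word_ne_nil (x : Data) : word x ≠ nil ↔ ∃ n : List Bool, TreeCode.code n = x :=
  allList_ne_nil isBool_ne_nil x

/-- The result of the evaluation of `cons t b` under `w`, from those of `b` and of its parts. -/
def evalStep (w t b v v₁ v₂ : Data) : Data :=
  ite t
    (ite (eq t (cons nil nil))
      (ite v (cons nil (ite v.tail nil (boolData true))) nil)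
      (ite b
        (ite v₁
          (ite v₂
            (ite (eq t (cons nil (cons nil nil)))
              (cons nil (ite v₁.tail v₂.tail nil))
              (ite (eq t (cons (cons nil nil) nil))
                (cons nil (ite v₁.tail (boolData true) v₂.tail))
                nil))
            nil)
          nil)
        nil))
    (ite (word b) (cons nil (mem b w)) nil)

/-- Evaluation of the code of a formula under the assignment that makes the variables in the list
`w` true.  The result is the leaf on trees that are no codes of formulae; otherwise the right part
of the result is the truth value. -/
def eval (w : Data) : Data → Data
  | nil => cons nil nil
  | cons t b => evalStep w t b (eval w b) (eval w b.head) (eval w b.tail)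
termination_by x => x.size
decreasing_by
  · simp only [size]; omega
  · have := b.size_head_le; simp only [size]; omega
  · have := b.size_tail_le; simp only [size]; omega

/-- A successful result pairs the leaf with a truth value of size at most 3, which gives 5; truth
values passed on from operands obey the same bound. -/
theorem size_evalStep_le (w t b v v₁ v₂ : Data) (h₁ : v₁.size ≤ 5) (h₂ : v₂.size ≤ 5) :
    (evalStep w t b v v₁ v₂).size ≤ 5 := by
  have e₁ : v₁.tail.size ≤ 3 := by
    rcases v₁ with _ | ⟨l, r⟩
    · simp [tail, size]
    · have := l.size_pos
      simp only [size, tail] at h₁ ⊢; omega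
  have e₂ : v₂.tail.size ≤ 3 := by
    rcases v₂ with _ | ⟨l, r⟩
    · simp [tail, size]
    · have := l.size_pos
      simp only [size, tail] at h₂ ⊢; omega
  have hi : ∀ x y z : Data, y.size ≤ 5 → z.size ≤ 5 → (ite x y z).size ≤ 5 := fun x y z hy hz =>
    (size_ite_le x y z).trans (max_le hy hz)
  have hi' : ∀ x y z : Data, y.size ≤ 3 → z.size ≤ 3 → (cons nil (ite x y z)).size ≤ 5 := by
    intro x y z hy hz
    have := (size_ite_le x y z).trans (max_le hy hz)
    simp only [size]; omega
  have hn : nil.size ≤ 3 := by simp [size]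
  have hn' : nil.size ≤ 5 := by simp [size]
  have hb := size_boolData_le true
  have hm := size_mem_le b w
  have hc : (cons nil (mem b w)).size ≤ 5 := by simp only [size]; omega
  exact hi _ _ _ (hi _ _ _ (hi _ _ _ (hi' _ _ _ hn hb) hn') (hi _ _ _ (hi _ _ _ (hi _ _ _
    (hi _ _ _ (hi' _ _ _ e₂ hn) (hi _ _ _ (hi' _ _ _ hb e₂) hn')) hn') hn') hn'))
    (hi _ _ _ hc hn')

theorem size_eval_le (w x : Data) : (eval w x).size ≤ 5 := by
  induction h : x.size using Nat.strong_induction_on generalizing x with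
  | _ n ih =>
    subst h
    rcases x with _ | ⟨t, b⟩
    · simp [eval, size]
    · have h₁ := b.size_head_le
      have h₂ := b.size_tail_le
      rw [eval]
      exact size_evalStep_le _ _ _ _ _ _ (ih _ (by simp only [size]; omega) _ rfl)
        (ih _ (by simp only [size]; omega) _ rfl)

/-- Evaluation doubles as a parser: it fails unless the tag is known and the operands required by
that tag evaluate. -/
theorem exists_formula_of_eval_ne_nil (w x : Data) (hx : eval w x ≠ nil) :
    ∃ φ : Formula, TreeCode.code φ = x := by
  induction h : x.size using Nat.strong_induction_on generalizing x with
  | _ n ih =>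
    subst h
    rcases x with _ | ⟨t, b⟩
    · exact ⟨.bot, rfl⟩
    have h₁ := b.size_head_le
    have h₂ := b.size_tail_le
    have ih₀ := fun h => ih b.size (by simp only [size]; omega) b h rfl
    have ih₁ := fun h => ih b.head.size (by simp only [size]; omega) b.head h rfl
    have ih₂ := fun h => ih b.tail.size (by simp only [size]; omega) b.tail h rfl
    rw [eval, evalStep] at hx
    rcases t with _ | ⟨t₁, t₂⟩
    · rw [ite_nil, ite_ne_nil, word_ne_nil] at hx
      obtain ⟨⟨n, rfl⟩, _⟩ := hx
      exact ⟨.var n, rfl⟩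
    rw [ite_of_ne (x := cons t₁ t₂) Data.noConfusion] at hx
    by_cases hn : cons t₁ t₂ = cons nil nil
    · rw [ite_of_ne ((eq_ne_nil _ _).2 hn), ite_ne_nil] at hx
      obtain ⟨φ, rfl⟩ := ih₀ hx.1
      rw [hn]
      exact ⟨.neg φ, rfl⟩
    rw [not_not.1 (mt (eq_ne_nil _ _).1 hn), ite_nil, ite_ne_nil, ite_ne_nil, ite_ne_nil] at hx
    obtain ⟨hb, hx₁, hx₂, hx⟩ := hx
    -- Both parts of the leaf would pass as codes of `bot`; the test of `b` in `evalStep` excludes a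
    -- binary connective without operands.
    rcases b with _ | ⟨l, r⟩
    · exact absurd rfl hb
    obtain ⟨φ, hφ⟩ := ih₁ hx₁
    obtain ⟨ψ, hψ⟩ := ih₂ hx₂
    simp only [head, tail] at hφ hψ
    subst hφ hψ
    by_cases ha : cons t₁ t₂ = cons nil (cons nil nil)
    · rw [ha]
      exact ⟨.and φ ψ, rfl⟩
    rw [not_not.1 (mt (eq_ne_nil _ _).1 ha), ite_nil, ite_ne_nil, eq_ne_nil] at hx
    rw [hx.1]
    exact ⟨.or φ ψ, rfl⟩

end Data

theorem FP.word {A : Set Data} {f : Data → Data} (hf : FP A f) : FP A fun x => Data.word (f x) :=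
  .allList (.isBool .id) hf

theorem FP.eval {A : Set Data} {f g : Data → Data} (hf : FP A f) (hg : FP A g) :
    FP A fun x => Data.eval (f x) (g x) := by
  refine deepRec (g := Data.evalStep) (fun p => by rw [Data.eval]) (fun p l r => by rw [Data.eval])
    (const _) ?_ 5 Data.size_eval_le hf hg
  intro a b c d e e' ha hb hc hd he he'
  exact .ite hb (.ite (.eq hb (const _)) (.ite hd (.cons nil (.ite hd.tail nil (const _))) nil)
    (.ite hc (.ite he (.ite he' (.ite (.eq hb (const _)) (.cons nil (.ite he.tail he'.tail nil))
      (.ite (.eq hb (const _)) (.cons nil (.ite he.tail (const _) he'.tail)) nil)) nil) nil) nil))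
    (.ite (.word hc) (.cons nil (.mem hc ha)) nil)

namespace Data

open Classical in
/-- The assignment that makes the variables in a list true. -/
noncomputable def assignment (w : Data) (n : List Bool) : Bool :=
  decide (mem (TreeCode.code n) w ≠ nil)

/-- The outer `cons` separates the truth value "false" from failure to parse. -/
theorem eval_code (w : Data) (φ : Formula) : ∃ v, eval w (TreeCode.code φ) = cons nil v ∧
    (v ≠ nil ↔ φ.Holds (assignment w)) := by
  have hc : ∀ x y, cons x y ≠ nil := fun _ _ => Data.noConfusion
  induction φ with
  | bot => exact ⟨nil, by rw [show TreeCode.code Formula.bot = nil from rfl, eval],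
      by simp [Formula.Holds]⟩
  | var n =>
    refine ⟨mem (TreeCode.code n) w, ?_, by simp [Formula.Holds, assignment]⟩
    rw [show TreeCode.code (Formula.var n) = cons nil (TreeCode.code n) from rfl, eval, evalStep,
      ite_nil, ite_of_ne ((word_ne_nil _).2 ⟨n, rfl⟩)]
  | neg φ ih =>
    obtain ⟨v, h, h'⟩ := ih
    refine ⟨ite v nil (boolData true), ?_, ?_⟩
    · rw [show TreeCode.code (Formula.neg φ) = cons (cons nil nil) (TreeCode.code φ) from rfl, eval,
        evalStep, h]
      rfl
    · rw [Formula.Holds, ← h']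
      cases v <;> simp [ite, boolData]
  | and φ ψ ih ih' =>
    obtain ⟨v₁, h₁, e₁⟩ := ih
    obtain ⟨v₂, h₂, e₂⟩ := ih'
    refine ⟨ite v₁ v₂ nil, ?_, ?_⟩
    · rw [show TreeCode.code (Formula.and φ ψ) = cons (cons nil (cons nil nil))
        (cons (TreeCode.code φ) (TreeCode.code ψ)) from rfl, eval, evalStep]
      simp only [head, tail, h₁, h₂]
      rfl
    · rw [Formula.Holds, ← e₁, ← e₂, ite_ne_nil]
  | or φ ψ ih ih' =>
    obtain ⟨v₁, h₁, e₁⟩ := ih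
    obtain ⟨v₂, h₂, e₂⟩ := ih'
    refine ⟨ite v₁ (boolData true) v₂, ?_, ?_⟩
    · rw [show TreeCode.code (Formula.or φ ψ) = cons (cons (cons nil nil) nil)
        (cons (TreeCode.code φ) (TreeCode.code ψ)) from rfl, eval, evalStep]
      simp only [head, tail, h₁, h₂]
      rfl
    · rw [Formula.Holds, ← e₁, ← e₂]
      cases v₁ <;> simp [ite, boolData]

end Data

theorem recognizable_formula (A : Set Data) : Recognizable A Formula := by
  refine ⟨fun x => Data.eval .nil x, .eval .nil .id, fun x =>
    ⟨Data.exists_formula_of_eval_ne_nil _ _, ?_⟩⟩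
  rintro ⟨φ, rfl⟩
  obtain ⟨v, h, _⟩ := Data.eval_code .nil φ
  simp [h]

/-! ### Short witnesses: satisfiability is in NP -/

namespace Formula

/-- The variables of a formula, in the order of their occurrences. -/
def vars : Formula → List (List Bool)
  | var n => [n]
  | bot => []
  | neg φ => vars φ
  | and φ ψ => vars φ ++ vars ψ
  | or φ ψ => vars φ ++ vars ψ

theorem holds_congr {v v' : List Bool → Bool} {φ : Formula} (h : ∀ n ∈ φ.vars, v n = v' n) :
    φ.Holds v ↔ φ.Holds v' := by
  induction φ with
  | var n => simp [Holds, h n (by simp [vars])]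
  | bot => rfl
  | neg φ ih => rw [Holds, Holds, ih h]
  | and φ ψ ih ih' =>
    rw [Holds, Holds, ih fun n hn => h n (List.mem_append_left _ hn),
      ih' fun n hn => h n (List.mem_append_right _ hn)]
  | or φ ψ ih ih' =>
    rw [Holds, Holds, ih fun n hn => h n (List.mem_append_left _ hn),
      ih' fun n hn => h n (List.mem_append_right _ hn)]

end Formula

theorem size_listData_append {α : Type} [TreeCode α] (l m : List α) :
    (listData (l ++ m)).size + 1 = (listData l).size + (listData m).size := by
  induction l with
  | nil => simp [listData, Data.size]; omega
  | cons a l ih => simp only [List.cons_append, listData, Data.size]; omega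

theorem size_listData_filter {α : Type} [TreeCode α] (p : α → Bool) (l : List α) :
    (listData (l.filter p)).size ≤ (listData l).size := by
  induction l with
  | nil => rfl
  | cons a l ih =>
    rw [List.filter_cons]
    split <;> simp only [listData, Data.size] <;> omega

theorem Formula.size_vars_le (φ : Formula) :
    (listData φ.vars).size ≤ (TreeCode.code φ).size := by
  induction φ with
  | var n =>
    change _ ≤ (Data.cons Data.nil (TreeCode.code n)).size
    simp only [vars, listData, Data.size]; omega
  | bot => exact le_rfl
  | neg φ ih =>
    change _ ≤ (Data.cons _ (TreeCode.code φ)).size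
    simp only [vars, Data.size]; omega
  | and φ ψ ih ih' =>
    change _ ≤ (Data.cons _ (.cons (TreeCode.code φ) (TreeCode.code ψ))).size
    have := size_listData_append φ.vars ψ.vars
    simp only [vars, Data.size]; omega
  | or φ ψ ih ih' =>
    change _ ≤ (Data.cons _ (.cons (TreeCode.code φ) (TreeCode.code ψ))).size
    have := size_listData_append φ.vars ψ.vars
    simp only [vars, Data.size]; omega

/-- The codes of satisfiable formulae. -/
def satSet : Set Data :=
  {x | ∃ w : Data, w.size ≤ x.size ∧ (Data.eval w x).tail ≠ .nil}

theorem satSet_mem_classNP : satSet ∈ classNP :=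
  ⟨_, FP.mem_classP (FP.tail (.eval (.tail .id) (.head .id))), .X, fun x => by
    simp [satSet, Data.head, Data.tail]⟩

/-- The size limit on witnesses loses nothing: only the variables occurring in the formula matter,
and the list of the true ones is no larger than the code. -/
theorem code_mem_satSet (φ : Formula) : TreeCode.code φ ∈ satSet ↔ Consistent {φ} := by
  constructor
  · rintro ⟨w, _, hw⟩
    obtain ⟨v, h, h'⟩ := Data.eval_code w φ
    rw [h] at hw
    exact ⟨_, fun ψ hψ => by rw [Set.mem_singleton_iff.1 hψ]; exact h'.1 hw⟩
  · rintro ⟨v, hv⟩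
    have hv := hv φ rfl
    refine ⟨listData (φ.vars.filter v),
      (size_listData_filter _ _).trans φ.size_vars_le, ?_⟩
    obtain ⟨u, h, h'⟩ := Data.eval_code (listData (φ.vars.filter v)) φ
    rw [h]
    refine h'.2 ((Formula.holds_congr fun n hn => ?_).1 hv)
    have : Data.mem (TreeCode.code n) (listData (φ.vars.filter v)) ≠ .nil ↔ v n = true := by
      rw [Data.mem_listData_ne_nil]
      constructor
      · rintro ⟨m, hm, e⟩
        rw [listData_injective boolData_injective e]
        exact (List.mem_filter.1 hm).2
      · exact fun hvn => ⟨n, List.mem_filter.2 ⟨hn, hvn⟩, rfl⟩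
    rw [Bool.eq_iff_iff, ← this]
    simp [Data.assignment]

/-! ## Conjunctions -/

namespace Formula

/-- The conjunction of a list of formulae. -/
def conj : List Formula → Formula
  | [] => neg bot
  | φ :: l => and φ (conj l)

theorem holds_conj (v : List Bool → Bool) (l : List Formula) :
    (conj l).Holds v ↔ ∀ φ ∈ l, φ.Holds v := by
  induction l with
  | nil => simp [conj, Holds]
  | cons φ l ih => simp [conj, Holds, ih]

end Formula

namespace Data

/-- The code of a conjunction. -/
def andCode (x y : Data) : Data := cons (cons nil (cons nil nil)) (cons x y)

/-- The code of a negation. -/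
def negCode (x : Data) : Data := cons (cons nil nil) x

/-- The code of the conjunction of a list of formulae. -/
def conj : Data → Data
  | nil => negCode nil
  | cons a r => andCode a (conj r)

theorem conj_code (l : List Formula) : conj (TreeCode.code l) = TreeCode.code (Formula.conj l) := by
  induction l with
  | nil => rfl
  | cons φ l ih => exact congrArg (andCode _) ih

theorem size_conj_le (x : Data) : (conj x).size ≤ 8 * x.size := by
  induction x with
  | nil => simp [conj, negCode, size]
  | cons a r _ ih =>
    -- An `and` adds seven nodes to its operands, less than the eight granted to the list cell.
    simp only [conj, andCode, size]
    omega

/-- The code of the conjunction of the consequences of a list of defaults and of a list `p` of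
formulae. -/
def conclusions (p : Data) : Data → Data
  | nil => conj p
  | cons d r => andCode d.tail.tail (conclusions p r)

theorem size_conclusions_le (p x : Data) : (conclusions p x).size ≤ 8 * (p.size + x.size) := by
  induction x with
  | nil => have := size_conj_le p; simp only [conclusions]; omega
  | cons d r _ ih =>
    have h₁ := d.size_tail_le
    have h₂ := d.tail.size_tail_le
    simp only [conclusions, andCode, size]
    omega

/-- The answers of the oracle on the members of a list. -/
noncomputable def queryList (A : Set Data) : Data → Data
  | nil => nil
  | cons a r => cons (query A a) (queryList A r)

theorem size_queryList_le (A : Set Data) (x : Data) : (queryList A x).size ≤ 4 * x.size := by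
  induction x with
  | nil => simp [queryList, size]
  | cons a r _ ih =>
    have : (query A a).size ≤ 3 := size_boolData_le _
    simp only [queryList, size]
    omega

theorem query_satSet_ne_nil (φ : Formula) :
    query satSet (TreeCode.code φ) ≠ nil ↔ Consistent {φ} := by
  classical rw [query, boolData_ne_nil, decide_eq_true_iff, code_mem_satSet]

theorem queryList_satSet (l : List Formula) :
    queryList satSet (TreeCode.code l) = TreeCode.code (testResults l) := by
  induction l with
  | nil => rfl
  | cons φ l ih =>
    exact congrArg₂ cons (congrArg boolData (decide_eq_decide.2 (code_mem_satSet φ))) ih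

end Data

namespace FP

variable {A : Set Data} {f g : Data → Data}

theorem andCode (hf : FP A f) (hg : FP A g) : FP A fun x => Data.andCode (f x) (g x) :=
  .cons (const _) (.cons hf hg)

theorem negCode (hf : FP A f) : FP A fun x => Data.negCode (f x) :=
  .cons (const _) hf

theorem conj (hf : FP A f) : FP A fun x => Data.conj (f x) :=
  fold (f := fun _ => Data.conj) (fun _ => rfl) (fun _ _ _ => rfl) (const _)
    (g := fun _ a _ w => Data.andCode a w) (fun _ _ _ _ _ hb _ hd => .andCode hb hd)
    (8 * .X) (fun p x => (Data.size_conj_le x).trans (by simp)) nil hf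

theorem conclusions (hf : FP A f) (hg : FP A g) : FP A fun x => Data.conclusions (f x) (g x) :=
  fold (f := Data.conclusions) (fun _ => rfl) (fun _ _ _ => rfl) (conj id)
    (g := fun _ d _ w => Data.andCode d.tail.tail w)
    (fun _ _ _ _ _ hb _ hd => .andCode hb.tail.tail hd)
    (8 * .X) (fun p x => by simpa using Data.size_conclusions_le p x) hf hg

theorem queryList (hf : FP A f) : FP A fun x => Data.queryList A (f x) :=
  fold (f := fun _ => Data.queryList A) (fun _ => rfl) (fun _ _ _ => rfl) nil
    (g := fun _ a _ w => Data.cons (Data.query A a) w)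
    (fun _ _ _ _ _ hb _ hd => .cons (.query hb) hd)
    (4 * .X) (fun p x => (Data.size_queryList_le A x).trans (by simp)) nil hf

end FP

theorem consistent_conj (l : List Formula) :
    Consistent {Formula.conj l} ↔ Consistent {φ | φ ∈ l} := by
  simp [Consistent, Formula.holds_conj]

theorem recognizable_default (A : Set Data) : Recognizable A Default := by
  have hf := recognizable_formula A
  obtain ⟨V, hV, h⟩ := hf.prod (hf.prod hf)
  refine ⟨V, hV, fun x => (h x).trans ⟨?_, ?_⟩⟩
  · rintro ⟨⟨a, b, c⟩, rfl⟩
    exact ⟨⟨a, b, c⟩, rfl⟩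
  · rintro ⟨⟨a, b, c⟩, rfl⟩
    exact ⟨(a, b, c), rfl⟩

/-- Consistency of the background theory is part of the type, so recognition has to ask the oracle
about the conjunction of the background formulae. -/
theorem recognizable_presentation : Recognizable satSet Presentation := by
  obtain ⟨V, hV, h⟩ := (recognizable_default satSet).list.prod (recognizable_formula satSet).list
  refine ⟨fun x => .ite (V x) (.query satSet (.conj x.tail)) .nil,
    .ite hV (.query (.conj (.tail .id))) .nil, fun x => ?_⟩
  rw [Data.ite_ne_nil, h]
  have hc : ∀ (D : List Default) (W : List Formula),
      Data.query satSet (.conj (TreeCode.code (D, W)).tail) ≠ .nil ↔ Consistent {φ | φ ∈ W} :=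
    fun D W => by
      rw [show (TreeCode.code (D, W)).tail = TreeCode.code W from rfl, Data.conj_code,
        Data.query_satSet_ne_nil, consistent_conj]
  constructor
  · rintro ⟨⟨⟨D, W⟩, rfl⟩, hx⟩
    exact ⟨⟨D, W, (hc D W).1 hx⟩, rfl⟩
  · rintro ⟨⟨D, W, hW⟩, rfl⟩
    exact ⟨⟨(D, W), rfl⟩, (hc D W).2 hW⟩

/-! ## Processes -/

namespace DefaultTheory

variable {T : DefaultTheory}

theorem conclusions_reverse (s : List Default) : T.conclusions s.reverse = T.conclusions s := by
  simp [conclusions]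

theorem isProc_append_singleton {s : List Default} {d : Default} :
    T.IsProc (s ++ [d]) ↔ T.IsProc s ∧ d ∉ s ∧ d ∈ T.D ∧ Consistent (T.conclusions (s ++ [d])) ∧
      Models (T.conclusions s) d.prec := by
  constructor
  · rintro ⟨h₁, h₂, h₃, h₄⟩
    have hn := List.nodup_append.1 h₁
    refine ⟨⟨hn.1, fun e he => h₂ e (List.mem_append_left _ he), ?_, ?_⟩, ?_, h₂ d (by simp), h₃,
      h₄ s d [] rfl⟩
    · obtain ⟨v, hv⟩ := h₃
      refine ⟨v, fun φ hφ => hv φ (hφ.imp_right ?_)⟩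
      rintro ⟨e, he, rfl⟩
      exact ⟨e, List.mem_append_left _ he, rfl⟩
    · rintro s₁ e s₂ rfl
      exact h₄ s₁ e (s₂ ++ [d]) (by simp)
    · exact fun hd => hn.2.2 d hd d (by simp) rfl
  · rintro ⟨⟨h₁, h₂, _, h₄⟩, hd, hD, h₃, hp⟩
    refine ⟨?_, ?_, h₃, ?_⟩
    · rw [List.nodup_append]
      refine ⟨h₁, by simp, ?_⟩
      rintro a ha b hb rfl
      exact hd (by rwa [List.mem_singleton.1 hb] at ha)
    · intro e he
      rcases List.mem_append.1 he with he | he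
      · exact h₂ e he
      · rwa [List.mem_singleton.1 he]
    · intro s₁ e s₂ h
      -- Either `e` is the appended default, or it occurs in `s` with the same predecessors.
      rcases List.eq_nil_or_concat s₂ with rfl | ⟨s₂, f, rfl⟩
      · obtain ⟨rfl, h'⟩ := List.append_inj' h rfl
        obtain ⟨rfl, _⟩ := List.cons.inj h'
        exact hp
      · rw [List.concat_eq_append, ← List.cons_append, ← List.append_assoc] at h
        exact h₄ _ _ _ (List.append_inj' h rfl).1

end DefaultTheory

/-- The tests and their combination that express a condition on processes. -/
structure ExpressedBy (C : DefaultTheory → List Default → Prop)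
    (tests : Presentation × List Default → List Formula)
    (combine : (Presentation × List Default) × List Bool → Bool) : Prop where
  tests_perm : ∀ (P : Presentation) (s s' : List Default), s.Perm s' → tests (P, s) = tests (P, s')
  combine_perm : ∀ (P : Presentation) (s s' : List Default) (r : List Bool), s.Perm s' →
    combine ((P, s), r) = combine ((P, s'), r)
  iff : ∀ (P : Presentation) (s : List Default), P.theory.IsProc s →
    (C P.theory s ↔ combine ((P, s), testResults (tests (P, s))) = true)

section Greedy

variable (tests : Presentation × List Default → List Formula)
  (combine : (Presentation × List Default) × List Bool → Bool) (P : Presentation)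

/-- The default `d` may be appended to the successful process whose reversal is `s`. -/
def Admissible (s : List Default) (d : Default) : Prop :=
  d ∉ s ∧ Models (P.theory.conclusions s) d.prec ∧ Consistent (P.theory.conclusions (d :: s)) ∧
    combine ((P, d :: s), testResults (tests (P, d :: s))) = true

open Classical in
/-- Append the default if possible. -/
noncomputable def addDefault (s : List Default) (d : Default) : List Default :=
  if Admissible tests combine P s d then d :: s else s

/-- Try to append each member of a list of defaults. -/
noncomputable def addDefaults (s : List Default) : List Default → List Default
  | [] => s
  | d :: l => addDefault tests combine P (addDefaults s l) d

/-- Starting from the empty process, try to append each default of the presentation, as often as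
the given list is long. -/
noncomputable def greedySequence : List Default → List Default
  | [] => []
  | _ :: l => addDefaults tests combine P (greedySequence l) P.defaults

variable {tests combine P}

/-- As long as nothing has been appended, every attempt is made on `s` itself; a round without
growth thus certifies that no default of `l` fits. -/
theorem length_lt_or_addDefaults_eq (s l : List Default) :
    s.length < (addDefaults tests combine P s l).length ∨
      addDefaults tests combine P s l = s ∧ ∀ d ∈ l, ¬ Admissible tests combine P s d := by
  induction l with
  | nil => exact .inr ⟨rfl, by simp⟩
  | cons d l ih =>
    rw [addDefaults, addDefault]
    rcases ih with ih | ⟨e, ih⟩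
    · left
      split
      · rw [List.length_cons]; omega
      · exact ih
    · rw [e]
      split
      · left; simp
      · rename_i h
        exact .inr ⟨rfl, by simpa [h] using ih⟩

theorem addDefaults_eq {s l : List Default} (h : ∀ d ∈ l, ¬ Admissible tests combine P s d) :
    addDefaults tests combine P s l = s := by
  induction l with
  | nil => rfl
  | cons d l ih =>
    rw [addDefaults, ih fun e he => h e (List.mem_cons_of_mem _ he), addDefault,
      if_neg (h d List.mem_cons_self)]

/-- Either every round so far added a default, or some round added none, and then all later rounds
change nothing. -/
theorem length_le_or_greedySequence_maximal (l : List Default) :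
    l.length ≤ (greedySequence tests combine P l).length ∨
      ∀ d ∈ P.defaults, ¬ Admissible tests combine P (greedySequence tests combine P l) d := by
  induction l with
  | nil => exact .inl (Nat.zero_le _)
  | cons _ l ih =>
    rw [greedySequence]
    rcases length_lt_or_addDefaults_eq (tests := tests) (combine := combine) (P := P)
      (greedySequence tests combine P l) P.defaults with h | ⟨e, h⟩
    · rcases ih with ih | ih
      · left
        rw [List.length_cons]; omega
      · rw [addDefaults_eq ih] at h
        exact absurd h (lt_irrefl _)
    · rw [e]
      exact .inr h

variable {S : DefaultSemantics}

/-- The list is built in reverse, while the order of a process matters for its preconditions. The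
consistency tests do not see the order, so they may be run on the reversed list. -/
theorem isSuccessful_reverse_cons (hS : ExpressedBy S.Successful tests combine)
    {s : List Default} {d : Default} (hs : S.IsSuccessful P.theory s.reverse) :
    S.IsSuccessful P.theory (d :: s).reverse ↔
      d ∈ P.defaults ∧ Admissible tests combine P s d := by
  have hp : (s.reverse ++ [d]).Perm (d :: s) := by
    rw [← List.reverse_cons]; exact List.reverse_perm _
  have hD : d ∈ P.theory.D ↔ d ∈ P.defaults := List.mem_toFinset
  rw [DefaultSemantics.IsSuccessful, and_congr_right (hS.iff P _), List.reverse_cons,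
    hS.tests_perm P _ _ hp, hS.combine_perm P _ _ _ hp, DefaultTheory.isProc_append_singleton,
    ← List.reverse_cons, DefaultTheory.conclusions_reverse, DefaultTheory.conclusions_reverse,
    List.mem_reverse, hD, Admissible]
  have := hs.1
  tauto

theorem isSuccessful_addDefaults (hS : ExpressedBy S.Successful tests combine)
    {s : List Default} (hs : S.IsSuccessful P.theory s.reverse) {l : List Default}
    (hl : ∀ d ∈ l, d ∈ P.defaults) :
    S.IsSuccessful P.theory (addDefaults tests combine P s l).reverse := by
  induction l with
  | nil => exact hs
  | cons d l ih =>
    have ih := ih fun e he => hl e (List.mem_cons_of_mem _ he)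
    rw [addDefaults, addDefault]
    split
    · rename_i h
      exact (isSuccessful_reverse_cons hS ih).2 ⟨hl d List.mem_cons_self, h⟩
    · exact ih

theorem isSuccessful_greedySequence (hS : ExpressedBy S.Successful tests combine)
    (h0 : S.IsSuccessful P.theory []) (l : List Default) :
    S.IsSuccessful P.theory (greedySequence tests combine P l).reverse := by
  induction l with
  | nil => exact h0
  | cons _ l ih => exact isSuccessful_addDefaults hS ih fun _ hd => hd

/-- Pigeonhole: if each round grew, appending one more default would give a repetition-free list of
members of `P.defaults` longer than `P.defaults`. -/
theorem greedySequence_maximal (hS : ExpressedBy S.Successful tests combine)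
    (h0 : S.IsSuccessful P.theory []) (d : Default) (hd : d ∈ P.defaults) :
    ¬ Admissible tests combine P (greedySequence tests combine P P.defaults) d := by
  rcases length_le_or_greedySequence_maximal (tests := tests) (combine := combine) (P := P)
    P.defaults with h | h
  · intro ha
    obtain ⟨hn, hm, _⟩ := ((isSuccessful_reverse_cons hS
      (isSuccessful_greedySequence hS h0 _)).2 ⟨hd, ha⟩).1
    have := (List.subperm_of_subset hn
      fun e he => (List.mem_toFinset (l := P.defaults)).1 (hm e he)).length_le
    rw [List.length_reverse, List.length_cons] at this
    omega
  · exact h d hd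

/-- Fail-safety supplies a closed continuation. Were it nonempty, antimonotonicity would keep its
first default appendable, against maximality; so the sequence itself is closed. -/
theorem closed_greedySequence (hS : ExpressedBy S.Successful tests combine)
    (hreg : S.Regular) (hsafe : S.FailSafe) :
    S.Closed P.theory (greedySequence tests combine P P.defaults).reverse := by
  have h0 := hreg.empty P.theory
  have hs := isSuccessful_greedySequence (P := P) hS h0 P.defaults
  obtain ⟨s', h₁, h₂⟩ := hsafe _ _ hs
  rcases s' with _ | ⟨d, s'⟩
  · simpa using h₂
  · rw [List.append_cons, ← List.reverse_cons] at h₁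
    obtain ⟨hd, ha⟩ := (isSuccessful_reverse_cons hS hs).1 (hreg.antimono _ _ _ h₁)
    exact absurd ha (greedySequence_maximal hS h0 d hd)

end Greedy

/-! ## The decision procedure -/

/-- The conjunction of the background theory and of the consequences of a list of defaults. -/
def conclusionsFormula (W : List Formula) : List Default → Formula
  | [] => .conj W
  | d :: s => .and d.cons (conclusionsFormula W s)

theorem holds_conclusionsFormula (P : Presentation) (s : List Default) (v : List Bool → Bool) :
    (conclusionsFormula P.background s).Holds v ↔ ∀ φ ∈ P.theory.conclusions s, φ.Holds v := by
  induction s with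
  | nil =>
    rw [conclusionsFormula, Formula.holds_conj]
    simp [DefaultTheory.conclusions, Presentation.theory]
  | cons d s ih =>
    rw [conclusionsFormula, Formula.Holds, ih]
    simp only [DefaultTheory.conclusions, Set.mem_ofPred_eq, List.mem_cons]
    constructor
    · rintro ⟨h, h'⟩ φ (hφ | ⟨e, rfl | he, rfl⟩)
      · exact h' _ (.inl hφ)
      · exact h
      · exact h' _ (.inr ⟨e, he, rfl⟩)
    · intro h
      refine ⟨h _ (.inr ⟨d, .inl rfl, rfl⟩), ?_⟩
      rintro φ (hφ | ⟨e, he, rfl⟩)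
      · exact h _ (.inl hφ)
      · exact h _ (.inr ⟨e, .inr he, rfl⟩)

theorem consistent_conclusionsFormula (P : Presentation) (s : List Default) :
    Consistent {conclusionsFormula P.background s} ↔ Consistent (P.theory.conclusions s) := by
  simp [Consistent, holds_conclusionsFormula]

/-- Entailment becomes one negated satisfiability query, used both for preconditions and for the
final answer. -/
theorem models_conclusions_iff (P : Presentation) (s : List Default) (φ : Formula) :
    Models (P.theory.conclusions s) φ ↔
      ¬ Consistent {.and (conclusionsFormula P.background s) (.neg φ)} := by
  simp [Consistent, Models, Formula.Holds, holds_conclusionsFormula]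

/-! ### The greedy construction carried out on codes -/

namespace Data

theorem conclusions_code (W : List Formula) (s : List Default) :
    conclusions (TreeCode.code W) (TreeCode.code s) = TreeCode.code (conclusionsFormula W s) := by
  induction s with
  | nil => exact conj_code W
  | cons d s ih => exact congrArg (andCode _) ih

variable (F G : Data → Data)

/-- The test whether a default may be appended to a process, where `F` computes the formulae to be
tested for successfulness, and `G` combines the results. -/
noncomputable def admissible (P s d : Data) : Data :=
  ite (mem d s) nil
    (ite (query satSet (andCode (conclusions P.tail s) (negCode d.head))) nil
      (ite (query satSet (conclusions P.tail (cons d s)))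
        (G (cons (cons P (cons d s)) (queryList satSet (F (cons P (cons d s))))))
        nil))

/-- Append the default if possible. -/
noncomputable def addDefault (P s d : Data) : Data :=
  ite (admissible F G P s d) (cons d s) s

/-- Try to append each member of a list of defaults. -/
noncomputable def addDefaults (p : Data) : Data → Data
  | nil => p.tail
  | cons d r => addDefault F G p.head (addDefaults p r) d

/-- Starting from the empty process, try to append each default of the presentation, as often as
the given list is long. -/
noncomputable def greedySequence (P : Data) : Data → Data
  | nil => nil
  | cons _ r => addDefaults F G (cons P (greedySequence P r)) P.head

theorem size_addDefaults_le (p t : Data) : (addDefaults F G p t).size ≤ p.tail.size + t.size := by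
  induction t with
  | nil => rw [addDefaults]; omega
  | cons d r _ ih =>
    refine (size_ite_le _ _ _).trans (max_le ?_ ?_) <;> simp only [size] <;> omega

/-- A round adds at most the size of the list of defaults, independently of the sequence reached so
far. Growth is therefore additive, and iterating the rounds stays polynomial. -/
theorem size_greedySequence_le (P t : Data) :
    (greedySequence F G P t).size ≤ 1 + t.size * P.size := by
  induction t with
  | nil => simp [greedySequence, size]
  | cons d r _ ih =>
    have h := size_addDefaults_le F G (cons P (greedySequence F G P r)) P.head
    have h' := P.size_head_le
    rw [greedySequence]
    simp only [tail, size] at h ⊢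
    have : (1 + d.size + r.size) * P.size = P.size + d.size * P.size + r.size * P.size := by ring
    omega

variable {F G} {tests : Presentation × List Default → List Formula}
  {combine : (Presentation × List Default) × List Bool → Bool}

theorem admissible_code_ne_nil (hF : ∀ a, F (TreeCode.code a) = TreeCode.code (tests a))
    (hG : ∀ a, G (TreeCode.code a) = TreeCode.code (combine a)) (P : Presentation)
    (s : List Default) (d : Default) :
    admissible F G (TreeCode.code P) (TreeCode.code s) (TreeCode.code d) ≠ nil ↔
      Admissible tests combine P s d := by
  have hi : ∀ x y : Data, ite x nil y ≠ nil ↔ ¬ x ≠ nil ∧ y ≠ nil := by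
    intro x y; cases x <;> simp [ite]
  have hm : mem (TreeCode.code d) (TreeCode.code s) ≠ nil ↔ d ∈ s := by
    refine (mem_listData_ne_nil _ _).trans ⟨?_, fun h => ⟨d, h, rfl⟩⟩
    rintro ⟨e, he, h⟩
    rwa [Default.code_injective h]
  -- The query looks for a countermodel, so a positive answer refutes the entailment of the
  -- precondition.
  have hp : query satSet (andCode (conclusions (TreeCode.code P).tail (TreeCode.code s))
      (negCode (TreeCode.code d).head)) ≠ nil ↔ ¬ Models (P.theory.conclusions s) d.prec := by
    rw [models_conclusions_iff, not_not, ← query_satSet_ne_nil]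
    exact Iff.of_eq (congrArg (fun x => query satSet (andCode x _) ≠ nil)
      (conclusions_code P.background s))
  have hc : query satSet (conclusions (TreeCode.code P).tail
      (cons (TreeCode.code d) (TreeCode.code s))) ≠ nil ↔
        Consistent (P.theory.conclusions (d :: s)) := by
    rw [← consistent_conclusionsFormula, ← query_satSet_ne_nil]
    exact Iff.of_eq (congrArg (fun x => query satSet x ≠ nil)
      (conclusions_code P.background (d :: s)))
  have hg : G (cons (cons (TreeCode.code P) (cons (TreeCode.code d) (TreeCode.code s)))
      (queryList satSet (F (cons (TreeCode.code P) (cons (TreeCode.code d) (TreeCode.code s)))))) ≠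
        nil ↔ combine ((P, d :: s), testResults (tests (P, d :: s))) = true := by
    rw [show cons (TreeCode.code P) (cons (TreeCode.code d) (TreeCode.code s)) =
      TreeCode.code (P, d :: s) from rfl, hF, queryList_satSet, ← boolData_ne_nil]
    exact Iff.of_eq (congrArg (fun x => x ≠ nil)
      (hG ((P, d :: s), testResults (tests (P, d :: s)))))
  rw [admissible, hi, hi, ite_ne_nil, hm, hp, hc, hg, not_not, Admissible]

theorem addDefault_code (hF : ∀ a, F (TreeCode.code a) = TreeCode.code (tests a))
    (hG : ∀ a, G (TreeCode.code a) = TreeCode.code (combine a)) (P : Presentation)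
    (s : List Default) (d : Default) :
    addDefault F G (TreeCode.code P) (TreeCode.code s) (TreeCode.code d) =
      TreeCode.code (_root_.addDefault tests combine P s d) := by
  have h := admissible_code_ne_nil hF hG P s d
  rw [addDefault, _root_.addDefault]
  split
  · rename_i ha
    rw [ite_of_ne (h.2 ha)]
    rfl
  · rename_i ha
    rw [not_not.1 (mt h.1 ha), ite_nil]

theorem addDefaults_code (hF : ∀ a, F (TreeCode.code a) = TreeCode.code (tests a))
    (hG : ∀ a, G (TreeCode.code a) = TreeCode.code (combine a)) (P : Presentation)
    (s l : List Default) :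
    addDefaults F G (cons (TreeCode.code P) (TreeCode.code s)) (TreeCode.code l) =
      TreeCode.code (_root_.addDefaults tests combine P s l) := by
  induction l with
  | nil => rfl
  | cons d l ih =>
    rw [_root_.addDefaults, ← addDefault_code hF hG, ← ih]
    rfl

theorem greedySequence_code (hF : ∀ a, F (TreeCode.code a) = TreeCode.code (tests a))
    (hG : ∀ a, G (TreeCode.code a) = TreeCode.code (combine a)) (P : Presentation)
    (l : List Default) :
    greedySequence F G (TreeCode.code P) (TreeCode.code l) =
      TreeCode.code (_root_.greedySequence tests combine P l) := by
  induction l with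
  | nil => rfl
  | cons d l ih =>
    rw [_root_.greedySequence, ← addDefaults_code hF hG, ← ih]
    rfl

end Data

/-! ### Polynomial time for the greedy construction -/

namespace FP

variable {F G a b c : Data → Data}

theorem addDefault (hF : FP satSet F) (hG : FP satSet G) (ha : FP satSet a) (hb : FP satSet b)
    (hc : FP satSet c) : FP satSet fun x => Data.addDefault F G (a x) (b x) (c x) :=
  .ite (.ite (.mem hc hb) nil (.ite (.query (.andCode (.conclusions ha.tail hb) (.negCode hc.head)))
    nil (.ite (.query (.conclusions ha.tail (.cons hc hb)))
      (hG.comp (.cons (.cons ha (.cons hc hb)) (.queryList (hF.comp (.cons ha (.cons hc hb)))))) nil)))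
    (.cons hc hb) hb

theorem addDefaults (hF : FP satSet F) (hG : FP satSet G) (ha : FP satSet a) (hb : FP satSet b) :
    FP satSet fun x => Data.addDefaults F G (a x) (b x) :=
  fold (f := Data.addDefaults F G) (fun _ => rfl) (fun _ _ _ => rfl) (.tail id)
    (g := fun p d _ w => Data.addDefault F G p.head w d)
    (fun _ _ _ _ ha hb _ hd => .addDefault hF hG ha.head hd hb) .X
    (fun p t => by
      have h₁ := Data.size_addDefaults_le F G p t
      have h₂ := p.size_tail_le
      rw [Polynomial.eval_X]
      omega) ha hb

theorem greedySequence (hF : FP satSet F) (hG : FP satSet G) (ha : FP satSet a)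
    (hb : FP satSet b) : FP satSet fun x => Data.greedySequence F G (a x) (b x) :=
  fold (f := Data.greedySequence F G) (fun _ => rfl) (fun _ _ _ => rfl) nil
    (g := fun p _ _ w => Data.addDefaults F G (.cons p w) p.head)
    (fun _ _ _ _ ha _ _ hd => .addDefaults hF hG (.cons ha hd) ha.head) (1 + .X * .X)
    (fun p t => (Data.size_greedySequence_le F G p t).trans (by
      simp only [Polynomial.eval_add, Polynomial.eval_mul, Polynomial.eval_one, Polynomial.eval_X]
      gcongr <;> omega)) ha hb

end FP

theorem mainTheorem7 (S : DefaultSemantics) (hreg : S.Regular) (hsafe : S.FailSafe) :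
    ∃ L ∈ classDeltaTwo, ∀ (P : Presentation) (a : Formula),
      S.Entails P.theory a ∨ S.Entails P.theory (Formula.neg a) →
        (TreeCode.code (P, a) ∈ L ↔ S.Entails P.theory a) := by
  obtain ⟨tests, combine, ht, hc, h₁, h₂, h₃⟩ := hreg.successful_tests
  have hS : ExpressedBy S.Successful tests combine := ⟨h₁, h₂, h₃⟩
  have hr := recognizable_presentation.prod (recognizable_default satSet).list
  obtain ⟨F, hF, hF'⟩ := ht.exists_FP hr presentationList_code_injective
  obtain ⟨G, hG, hG'⟩ := hc.exists_FP (hr.prod (recognizable_bool satSet).list)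
    (prodCode_injective presentationList_code_injective (listData_injective boolData_injective))
  -- The language: compute the greedy process and accept if its conclusions together with the
  -- negated query formula are unsatisfiable.
  have hL : FP satSet fun x => Data.ite (Data.query satSet (Data.andCode
      (Data.conclusions x.head.tail (Data.greedySequence F G x.head x.head.head))
      (Data.negCode x.tail))) .nil (boolData true) :=
    .ite (.query (.andCode (.conclusions (.tail (.head .id))
      (.greedySequence hF hG (.head .id) (.head (.head .id)))) (.negCode (.tail .id)))) .nil (.const _)
  refine ⟨_, ⟨satSet, satSet_mem_classNP, hL.mem_classP⟩, fun P a hPa => ?_⟩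
  set s := greedySequence tests combine P P.defaults with hs
  have hsucc := isSuccessful_greedySequence hS (hreg.empty P.theory) P.defaults
  have hext : S.IsExtension P.theory {φ | Models (P.theory.conclusions s) φ} :=
    ⟨s.reverse, hsucc, closed_greedySequence hS hreg hsafe,
      by rw [DefaultTheory.conclusions_reverse]⟩
  have hcode : Data.andCode (Data.conclusions (TreeCode.code (P, a)).head.tail
      (Data.greedySequence F G (TreeCode.code (P, a)).head (TreeCode.code (P, a)).head.head))
      (Data.negCode (TreeCode.code (P, a)).tail) =
        TreeCode.code (Formula.and (conclusionsFormula P.background s) (.neg a)) := by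
    have h := Data.greedySequence_code hF' hG' P P.defaults
    have h' := Data.conclusions_code P.background s
    rw [hs, ← h] at h'
    exact congrArg (fun x => Data.andCode x _) h'
  have hi : ∀ x : Data, Data.ite x .nil (boolData true) ≠ .nil ↔ ¬ x ≠ .nil := by
    intro x; cases x <;> simp [Data.ite, boolData]
  rw [Set.mem_ofPred_eq, hcode, hi, Data.query_satSet_ne_nil, ← models_conclusions_iff]
  -- The promise enters here: if the negation of `a` were in all extensions, a model of the
  -- conclusions of `s` would satisfy both it and `a`.
  refine ⟨fun hm => hPa.resolve_right fun hn => ?_, fun h => h _ hext⟩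
  obtain ⟨v, hv⟩ := hsucc.1.2.2.1
  rw [DefaultTheory.conclusions_reverse] at hv
  exact hn _ hext v hv (hm v hv)
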